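/- Fix $\kappa\in\mathbb R$ and $\theta\in(0,1]$. There is a constant $C>0$, depending only on $\kappa$ and $\theta$, such that the following holds. Let $p_{\mathrm{data}}$ be a probability measure on $\mathbb R^D$ with compact support $M$, let $\rho_0$ be an absolutely continuous probability measure on $\mathbb R^D$, let $F_0,\dots,F_{\tau-1}:\mathbb R^D\to\mathbb R^D$ be $C^1$ maps, $F^0=\mathrm{id}$, $F^{t+1}=F_t\circ F^t$, and let $T$ be an $L^2$-optimal transport map (a minimizer of the Monge problem with cost $\|T(y)-y\|^2$) from the generated law $F^\tau_\sharp\rho_0$ to $p_{\mathrm{data}}$. Let $n\ge 2$, $\delta>0$, $\epsilon_0>0$. Let $X_1,\dots,X_n$ be independent with law $\rho_0$, let $y_i=F^\tau(X_i)$ be the generated samples and $x_i=T(y_i)\sim p_{\mathrm{data}}$ the matched data samples. Let $E_t(x)$, $0\le t\le\tau$, be $D\times d$ matrices with orthonormal columns attached to the path started at $x$, with $E_0$ arbitrary (possibly random), evolved by the QR recursion $dF_t(F^t(x))\,E_t(x)=E_{t+1}(x)R_t$ with $R_t$ upper triangular; the columns of $E_\tau(X_i)$ span the most sensitive $d$-dimensional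 subspace at $y_i$. Assume * (convergence) with probability at least $1-\delta/2$, $\|T(y_i)-y_i\|\le\epsilon_0$ for all $i$; * (alignment) with probability at least $1-\delta/2$, for every $i$ with $x_i\in\partial M$, the columns of $E_\tau(X_i)$ span the tangent space $T_{x_i}\partial M$ (the linear span of the limits of secant directions of the topological boundary $\partial M$ at $x_i$). Let $\Phi:\mathbb R^D\to H$ be a strongly measurable feature map into a real inner product space with $\|\Phi\|\le\kappa$ on $M$. Then there is a solution $(w,\rho)$ of the one-class support vector problem on $x_1,\dots,x_n$, $$\min_{w,\rho}\ \tfrac12\|w\|^2-\rho\quad\text{subject to}\quad \langle w,\Phi(x_i)\rangle\ge\rho,\ i=1,\dots,n,$$ such that the binary classifier $f=\operatorname{sgn}(\langle w,\Phi(\cdot)\rangle+b):\mathbb R^D\to\{+1,-1\}$ (with $\operatorname{sgn}0=+1$), $b=-(1-\theta)\rho$, with confidence margin $m=\min_i(\langle w,\Phi(x_i)\rangle+b)$, has the following property: with probability at least $1-\delta$, if $m>0$ then for some $0\le c\le C/m$ $$P_{z\sim p_{\mathrm{data}}}\bigl(f(z)<0\bigr)\ \le\ c\,\frac{\log n}{n}+\frac1n\log\frac{n^2}{2\delta}.$$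 -/

import Mathlib

open MeasureTheory ProbabilityTheory

noncomputable section

/-- The sample space `ℝ^D` with its Euclidean norm. -/
abbrev Pt (D : ℕ) : Type := EuclideanSpace ℝ (Fin D)

/-- `P(A) ≥ q`, with `A` not required to be measurable: `A` contains a measurable set of
probability at least `q`. -/
def WithProbAtLeast {Ω : Type*} [MeasurableSpace Ω] (P : Measure Ω) (q : ℝ) (A : Set Ω) : Prop :=
  ∃ B : Set Ω, B ⊆ A ∧ MeasurableSet B ∧ ENNReal.ofReal q ≤ P B

/-- The composition `F^0 = id`, `F^(t+1) = F_t ∘ F^t` of the generating process. -/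
def flow {D : ℕ} (F : ℕ → Pt D → Pt D) : ℕ → Pt D → Pt D
  | 0 => id
  | t + 1 => F t ∘ flow F t

/-- The distribution `F^τ_♯ ρ₀` of the generated samples. -/
def generatedLaw {D : ℕ} (F : ℕ → Pt D → Pt D) (τ : ℕ) (ρ₀ : Measure (Pt D)) : Measure (Pt D) :=
  ρ₀.map (flow F τ)

/-- `T` is an `L²`-optimal transport map from `μ` to `ν`. -/
structure IsOptimalTransportMap {D : ℕ} (T : Pt D → Pt D) (μ ν : Measure (Pt D)) : Prop where
  measurable : Measurable T
  map_eq : μ.map T = ν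
  optimal : ∀ S : Pt D → Pt D, Measurable S → μ.map S = ν →
    ∫⁻ y, ENNReal.ofReal (‖T y - y‖ ^ 2) ∂μ ≤ ∫⁻ y, ENNReal.ofReal (‖S y - y‖ ^ 2) ∂μ

/-- `E t x` is the `D × d` matrix with orthonormal columns attached at time `t` to the sample path
started at `x`. It is evolved by the tangent dynamics `dF_t E_t = E_{t+1} R_t` (a QR decomposition)
from an arbitrary choice `E 0`; the columns of `E τ x` span the most sensitive `d`-dimensional
subspace at the end point `F^τ x`. -/
structure IsMostSensitiveBundle {D : ℕ} (F : ℕ → Pt D → Pt D) (τ d : ℕ)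
    (E : ℕ → Pt D → Fin d → Pt D) : Prop where
  orthonormal : ∀ t ≤ τ, ∀ x, Orthonormal ℝ (E t x)
  tangent : ∀ t < τ, ∀ x, ∃ R : Matrix (Fin d) (Fin d) ℝ, R.BlockTriangular id ∧
    ∀ j, fderiv ℝ (F t) (flow F t x) (E t x j) = ∑ i, R i j • E (t + 1) x i

/-- The tangent space at `x` to a subset `S` of `ℝ^D`: the linear span of the limits of secant
directions. For a `C¹` submanifold this is the usual tangent space. -/
def tangentSpaceOf {D : ℕ} (S : Set (Pt D)) (x : Pt D) : Submodule ℝ (Pt D) :=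
  Submodule.span ℝ (tangentConeAt ℝ S x)

/-- `(w, ρ)` solves the (hard margin) one-class support vector problem for the sample `x` and the
feature map `Φ`: minimize `‖w‖²/2 - ρ` subject to `⟪w, Φ (x i)⟫ ≥ ρ` for all `i`. -/
def IsOneClassSVM {D n : ℕ} {H : Type*} [NormedAddCommGroup H] [InnerProductSpace ℝ H]
    (Φ : Pt D → H) (x : Fin n → Pt D) (w : H) (ρ : ℝ) : Prop :=
  (∀ i, ρ ≤ inner ℝ w (Φ (x i))) ∧
    ∀ (w' : H) (ρ' : ℝ), (∀ i, ρ' ≤ inner ℝ w' (Φ (x i))) →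
      ‖w‖ ^ 2 / 2 - ρ ≤ ‖w'‖ ^ 2 / 2 - ρ'

/-- The binary classifier `sgn(⟪w, Φ z⟫ + b)`, with value `+1` on the hyperplane. -/
def kernelClassifier {D : ℕ} {H : Type*} [NormedAddCommGroup H] [InnerProductSpace ℝ H]
    (Φ : Pt D → H) (w : H) (b : ℝ) (z : Pt D) : ℤ :=
  open Classical in if 0 ≤ inner ℝ w (Φ z) + b then 1 else -1

/-- The confidence margin of `sgn(⟪w, Φ ·⟫ + b)` on a sample all of whose labels are `+1`. -/
def confidenceMargin {D n : ℕ} {H : Type*} [NormedAddCommGroup H] [InnerProductSpace ℝ H]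
    (Φ : Pt D → H) (w : H) (b : ℝ) (x : Fin n → Pt D) : ℝ :=
  ⨅ i, (inner ℝ w (Φ (x i)) + b)

end

/-! The matched samples `x i` are independent with law `pdata`, being images of the starting points
under `T ∘ flow F τ`, so the claim is a generalization bound for the one-class SVM. It is proved by
sample compression against a ghost sample.

At an optimum `‖w‖² = ρ`, so the margin is `m = θρ`. The multiple `v = (2κ²/(θρ)) w` then separates
the sample from the rejected points of the support with margin `κ²` on both sides of `t = (2/θ -
1)κ²`, and `‖v‖² = yκ²` with `y = 4κ²/(θm)`. By the perceptron argument (`exists_corrections`),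
about `y` corrections produce a vector that still separates the sample from any finite set of
rejected points, and this vector is a signed sum of few features.

To make the rejected region `B` visible, `N` ghost points are drawn. The vector found is determined
by at most `k` of the `n + N` points, with at most `(n + N + 1) ^ k` records. For a fixed record the
unused points are independent of the vector, so accepting all unused sample points is unlikely
precisely when many ghost points are rejected. Weighting each rejected ghost point by `1 + u` makes
the two effects cancel in expectation (`lintegral_sampleWeight_le`). Since `B` forces the weight up
to `(1 + u μ B) ^ N` on average, Markov's inequality bounds the probability of a large `B`
(`mul_measure_separatedSamples_le`). As `k` depends on the random `ρ`, a union bound over `k < n`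
finishes the proof. -/

open scoped ENNReal

/-! ### The one-class support vector problem -/

section OneClassSVM

variable {D n : ℕ} {H : Type*} [NormedAddCommGroup H] [InnerProductSpace ℝ H]

/-- The point of least norm in the convex hull of the features solves the one-class problem. -/
theorem exists_isOneClassSVM (hn : 0 < n) (Φ : Pt D → H) (x : Fin n → Pt D) :
    ∃ (w : H) (ρ : ℝ), IsOneClassSVM Φ x w ρ := by
  set K : Set H := convexHull ℝ (Set.range fun i => Φ (x i)) with hK
  have hmem : ∀ i, Φ (x i) ∈ K := fun i => subset_convexHull ℝ _ ⟨i, rfl⟩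
  have hcpt : IsCompact K := (Set.finite_range _).isCompact_convexHull ℝ
  obtain ⟨p, hpK, hp⟩ := hcpt.exists_isMinOn ⟨_, hmem ⟨0, hn⟩⟩ continuous_norm.continuousOn
  have hinf : ‖(0 : H) - p‖ = ⨅ q : K, ‖(0 : H) - q‖ := by
    have : Nonempty K := ⟨⟨p, hpK⟩⟩
    refine le_antisymm (le_ciInf fun q => ?_)
      (ciInf_le ⟨0, fun _ ⟨_, h⟩ => h ▸ norm_nonneg _⟩ (⟨p, hpK⟩ : K))
    simpa using hp q.2
  have hvar := (norm_eq_iInf_iff_real_inner_le_zero (convex_convexHull ℝ _) hpK).1 hinf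
  refine ⟨p, ‖p‖ ^ 2, fun i => ?_, fun w' ρ' h => ?_⟩
  · have := hvar _ (hmem i)
    rw [zero_sub, inner_neg_left, inner_sub_right, real_inner_self_eq_norm_sq] at this
    linarith
  · have hsub : K ⊆ {q | ρ' ≤ inner ℝ w' q} := by
      refine convexHull_min (by rintro _ ⟨i, rfl⟩; exact h i) ?_
      exact convex_halfSpace_ge (innerₛₗ ℝ w').isLinear ρ'
    -- With `2⟪w', p⟫ ≤ ‖w'‖² + ‖p‖²` this gives an objective of at least `-‖p‖²/2`, the value at
    -- `(p, ‖p‖²)`.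
    have h1 : ρ' ≤ inner ℝ w' p := hsub hpK
    have h2 := norm_sub_sq_real w' p
    nlinarith [sq_nonneg ‖w' - p‖]

/-- Feasibility is preserved by the scaling `(s • w, s * ρ)` with `s ≥ 0`, so `s = 1` minimizes
`s²‖w‖²/2 - sρ`. The competitor `s = ρ/‖w‖²` forces equality; `w = 0` is handled by `s = 2`. -/
theorem IsOneClassSVM.norm_sq_eq {Φ : Pt D → H} {x : Fin n → Pt D} {w : H} {ρ : ℝ}
    (h : IsOneClassSVM Φ x w ρ) : ‖w‖ ^ 2 = ρ := by
  have key : ∀ s : ℝ, 0 ≤ s → ‖w‖ ^ 2 / 2 - ρ ≤ s ^ 2 * ‖w‖ ^ 2 / 2 - s * ρ := by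
    intro s hs
    have := h.2 (s • w) (s * ρ) fun i => by
      rw [real_inner_smul_left]
      exact mul_le_mul_of_nonneg_left (h.1 i) hs
    rwa [norm_smul, Real.norm_of_nonneg hs, mul_pow] at this
  by_contra hne
  set a := ‖w‖ ^ 2
  have ha : 0 ≤ a := sq_nonneg _
  have h0 := key 0 le_rfl
  have hρ : 0 ≤ ρ := by linarith
  rcases eq_or_lt_of_le ha with h00 | ha'
  · have := key 2 (by norm_num)
    rw [← h00] at this h0 hne
    have : ρ ≤ 0 := by linarith
    exact hne (by linarith)
  · have := key (ρ / a) (by positivity)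
    have e : (ρ / a) ^ 2 * a / 2 - ρ / a * ρ = -(ρ ^ 2 / a) / 2 := by field_simp; ring
    rw [e] at this
    have h3 : (a - ρ) ^ 2 / a = a - 2 * ρ + ρ ^ 2 / a := by field_simp; ring
    have h4 : 0 < (a - ρ) ^ 2 / a := by
      have : a - ρ ≠ 0 := sub_ne_zero.2 hne
      positivity
    linarith

/-- If every constraint were slack, raising `ρ` to the least inner product would lower the
objective. -/
theorem IsOneClassSVM.exists_inner_le (hn : 0 < n) {Φ : Pt D → H} {x : Fin n → Pt D} {w : H}
    {ρ : ℝ} (h : IsOneClassSVM Φ x w ρ) : ∃ i, inner ℝ w (Φ (x i)) ≤ ρ := by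
  have : Nonempty (Fin n) := ⟨⟨0, hn⟩⟩
  obtain ⟨i, hi⟩ := Finite.exists_min fun i => inner ℝ w (Φ (x i))
  refine ⟨i, ?_⟩
  have := h.2 w _ hi
  linarith

theorem IsOneClassSVM.confidenceMargin_eq (hn : 0 < n) {Φ : Pt D → H} {x : Fin n → Pt D} {w : H}
    {ρ : ℝ} (h : IsOneClassSVM Φ x w ρ) (b : ℝ) : confidenceMargin Φ w b x = ρ + b := by
  have : Nonempty (Fin n) := ⟨⟨0, hn⟩⟩
  obtain ⟨i, hi⟩ := h.exists_inner_le hn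
  refine le_antisymm ?_ (le_ciInf fun j => by linarith [h.1 j])
  exact (ciInf_le (Set.finite_range _).bddBelow i).trans (by linarith)

end OneClassSVM

/-! ### A mistake bound of perceptron type -/

section Perceptron

variable {H : Type*} [NormedAddCommGroup H] [InnerProductSpace ℝ H]

/-- If every violated constraint `i` at `q` has a short `ψ i` well correlated with `v - q`, then
adding `ψ i` for violated constraints terminates after `k` corrections, where `‖v - q₀‖² ≤ k κ²`. -/
theorem exists_corrections {ι : Type*} {κ : ℝ} (hκ : 0 < κ) (ψ : Option ι → H) (h_none : ψ none = 0)
    (ok : ι → H → Prop) (v : H)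
    (hok : ∀ i q, ¬ ok i q → ‖ψ (some i)‖ ≤ κ ∧ κ ^ 2 ≤ inner ℝ (v - q) (ψ (some i))) :
    ∀ (k : ℕ) (q₀ : H), ‖v - q₀‖ ^ 2 ≤ k * κ ^ 2 →
      ∃ s : Fin k → Option ι, ∀ i, ok i (q₀ + ∑ j, ψ (s j)) := by
  intro k
  induction k with
  | zero =>
    intro q₀ h
    have hv : v - q₀ = 0 := by
      have : ‖v - q₀‖ ^ 2 ≤ 0 := by simpa using h
      exact norm_eq_zero.1 (pow_eq_zero_iff two_ne_zero |>.1 (le_antisymm this (sq_nonneg _)))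
    refine ⟨Fin.elim0, fun i => ?_⟩
    by_contra hi
    have := (hok i _ hi).2
    simp only [Finset.univ_eq_empty, Finset.sum_empty, add_zero, hv, inner_zero_left] at this
    exact absurd this (not_le.2 (by positivity))
  | succ k ih =>
    intro q₀ h
    by_cases hall : ∀ i, ok i q₀
    -- Early termination is padded with `none`, so that every record has length exactly `k`.
    · exact ⟨fun _ => none, by simpa [h_none] using hall⟩
    · push Not at hall
      obtain ⟨i, hi⟩ := hall
      -- The cross term contributes at most `-2κ²` and the square at most `κ²`, so each correction
      -- lowers the squared distance to `v` by `κ²`.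
      have hdec : ‖v - (q₀ + ψ (some i))‖ ^ 2 ≤ k * κ ^ 2 := by
        have e := norm_sub_sq_real (v - q₀) (ψ (some i))
        rw [← sub_sub, e]
        obtain ⟨h0, h1⟩ := hok i _ hi
        have h2 : ‖ψ (some i)‖ ^ 2 ≤ κ ^ 2 := pow_le_pow_left₀ (norm_nonneg _) h0 2
        push_cast at h
        linarith
      obtain ⟨s, hs⟩ := ih _ hdec
      refine ⟨Fin.cons (some i) s, fun j => ?_⟩
      simpa [Fin.sum_univ_succ, add_assoc] using hs j

end Perceptron

/-! ### Products over the free coordinates of a product measure -/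

section Product

theorem lintegral_pi_prod {ι Z : Type*} [Fintype ι] [MeasurableSpace Z] (μ : Measure Z)
    [IsProbabilityMeasure μ] (c : ι → Z → ℝ≥0∞) (hc : ∀ i, Measurable (c i)) :
    ∫⁻ z, ∏ i, c i (z i) ∂(Measure.pi fun _ : ι => μ) = ∏ i, ∫⁻ y, c i y ∂μ := by
  rw [lintegral_prod_eq_prod_lintegral_of_indepFun Finset.univ (fun i (z : ι → Z) => c i (z i))
    (iIndepFun_pi fun i => (hc i).aemeasurable) fun i => (hc i).comp (measurable_pi_apply i)]
  refine Finset.prod_congr rfl fun i _ => ?_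
  exact (measurePreserving_eval (fun _ : ι => μ) i).lintegral_comp (hc i)

/-- A product of factors indexed by `R`, whose dependence on the sample other than through their own
coordinate is only through the coordinates off `R`, is integrated factor by factor. -/
theorem lintegral_pi_prod_le {ι Z : Type*} [Fintype ι] [DecidableEq ι] [MeasurableSpace Z]
    (μ : Measure Z) [IsProbabilityMeasure μ] (R : Finset ι) (c : ι → (ι → Z) → Z → ℝ≥0∞)
    (hc : ∀ i z, Measurable (c i z)) (hcm : ∀ i, Measurable fun z : ι → Z => c i z (z i))
    (hdep : ∀ z z' : ι → Z, (∀ i ∉ R, z i = z' i) → ∀ i, c i z = c i z') (B : ℝ≥0∞)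
    (hB : ∀ z, ∏ i ∈ R, ∫⁻ y, c i z y ∂μ ≤ B) :
    ∫⁻ z, ∏ i ∈ R, c i z (z i) ∂(Measure.pi fun _ : ι => μ) ≤ B := by
  have hm : Measurable fun z : ι → Z => ∏ i ∈ R, c i z (z i) :=
    Finset.measurable_prod _ fun i _ => hcm i
  refine (lintegral_le_of_lmarginal_le (μ := fun _ : ι => μ) R hm
    (measurable_const (a := B)) fun z => ?_).trans_eq (by simp)
  have h1 : ∀ y : R → Z, ∏ i ∈ R, c i (Function.updateFinset z R y) (Function.updateFinset z R y i)
      = ∏ i : R, c i z (y i) := by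
    intro y
    rw [← Finset.prod_coe_sort]
    refine Finset.prod_congr rfl fun i _ => ?_
    rw [hdep (Function.updateFinset z R y) z fun j hj => by simp [Function.updateFinset, hj]]
    simp [Function.updateFinset]
  simp only [lmarginal, h1]
  rw [lintegral_pi_prod μ (fun i : R => c i z) fun i => hc i z,
    Finset.prod_coe_sort R fun i => ∫⁻ y, c i z y ∂μ]
  simpa using hB z

end Product

/-! ### Compression against a ghost sample -/

section Ghost

variable {Z H : Type*} [NormedAddCommGroup H]

/-- The features of the first sample, and the negatives of those of the second. -/
noncomputable def signedFeature {α β : Type*} (Φ : Z → H) (z : α ⊕ β → Z) : Option (α ⊕ β) → H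
  | none => 0
  | some (.inl i) => Φ (z (.inl i))
  | some (.inr j) => -Φ (z (.inr j))

/-- The weight vector obtained from the corrections recorded by `s`. -/
noncomputable def correctionSum {α β : Type*} {k : ℕ} (Φ : Z → H) (s : Fin k → Option (α ⊕ β))
    (z : α ⊕ β → Z) : H :=
  ∑ j, signedFeature Φ z (s j)

/-- The coordinates of the sample that are not used by `s`. -/
def freeCoords {ι : Type*} [Fintype ι] [DecidableEq ι] {k : ℕ} (s : Fin k → Option ι) :
    Finset ι :=
  Finset.univ.filter fun i => ∀ j, s j ≠ some i

theorem card_compl_freeCoords_le {ι : Type*} [Fintype ι] [DecidableEq ι] {k : ℕ}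
    (s : Fin k → Option ι) : (freeCoords s)ᶜ.card ≤ k := by
  have hsub : (freeCoords s)ᶜ.image some ⊆ Finset.univ.image s := by
    intro o ho
    obtain ⟨i, hi, rfl⟩ := Finset.mem_image.1 ho
    simp only [freeCoords, Finset.compl_filter, Finset.mem_filter, Finset.mem_univ, true_and,
      not_forall, not_not] at hi
    obtain ⟨j, hj⟩ := hi
    exact Finset.mem_image.2 ⟨j, Finset.mem_univ _, hj⟩
  calc (freeCoords s)ᶜ.card = ((freeCoords s)ᶜ.image some).card :=
        (Finset.card_image_of_injective _ (Option.some_injective _)).symm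
    _ ≤ (Finset.univ.image s).card := Finset.card_le_card hsub
    _ ≤ k := Finset.card_image_le.trans (by simp)

/-- This is the independence behind compression: once the used points are fixed, the classifier is
fixed too, as `lintegral_pi_prod_le` requires. -/
theorem correctionSum_congr {α β : Type*} [Fintype α] [Fintype β] [DecidableEq α]
    [DecidableEq β] {k : ℕ} (Φ : Z → H) (s : Fin k → Option (α ⊕ β)) {z z' : α ⊕ β → Z}
    (h : ∀ i ∉ freeCoords s, z i = z' i) : correctionSum Φ s z = correctionSum Φ s z' := by
  refine Finset.sum_congr rfl fun j _ => ?_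
  have hj : ∀ i, s j = some i → z i = z' i := fun i hi => h i fun hmem =>
    (Finset.mem_filter.1 hmem).2 j hi
  rcases hs : s j with _ | i | i
  · rfl
  · simp [signedFeature, hj _ hs]
  · simp [signedFeature, hj _ hs]

theorem stronglyMeasurable_correctionSum {α β : Type*} [MeasurableSpace Z] {k : ℕ}
    {Φ : Z → H}
    (hΦ : StronglyMeasurable Φ) (s : Fin k → Option (α ⊕ β)) :
    StronglyMeasurable (correctionSum Φ s) := by
  refine Finset.stronglyMeasurable_fun_sum _ fun j _ => ?_
  rcases s j with _ | i | i
  · exact stronglyMeasurable_const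
  · exact hΦ.comp_measurable (measurable_pi_apply _)
  · exact (hΦ.comp_measurable (measurable_pi_apply _)).neg

variable [InnerProductSpace ℝ H]

/-- The weight of one sample point under the classifier `t ≤ ⟪q, Φ ·⟫`: points of the first sample
have to be accepted, and rejected points of the second sample are rewarded by the factor `1 + u`. -/
noncomputable def pointWeight {α β : Type*} (Φ : Z → H) (t : ℝ) (u : ℝ≥0∞) (q : H) :
    α ⊕ β → Z → ℝ≥0∞
  | .inl _ => {y | t ≤ inner ℝ q (Φ y)}.indicator 1
  | .inr _ => fun y => 1 + u * {y | inner ℝ q (Φ y) < t}.indicator 1 y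

/-- The total weight of a double sample, summed over all records of `k` corrections. -/
noncomputable def sampleWeight {α β : Type*} [Fintype α] [Fintype β] [DecidableEq α]
    [DecidableEq β] (Φ : Z → H) (t : ℝ) (u : ℝ≥0∞) (k : ℕ) (z : α ⊕ β → Z) : ℝ≥0∞ :=
  ∑ s : Fin k → Option (α ⊕ β),
    ∏ i ∈ freeCoords s, pointWeight Φ t u (correctionSum Φ s z) i (z i)

/-- A separator `v` of the first sample from `B` is witnessed by a record of `k` corrections. -/
theorem prod_le_sampleWeight {Φ : Z → H} {κ t : ℝ} (hκ : 0 < κ) (u : ℝ≥0∞) {n N k : ℕ}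
    (x : Fin n → Z) (g : Fin N → Z) (v : H) (B : Set Z) (hv : ‖v‖ ^ 2 ≤ k * κ ^ 2)
    (hx : ∀ i, ‖Φ (x i)‖ ≤ κ ∧ t + κ ^ 2 ≤ inner ℝ v (Φ (x i)))
    (hB : ∀ y ∈ B, ‖Φ y‖ ≤ κ ∧ inner ℝ v (Φ y) < t - κ ^ 2) :
    ∏ j, (1 + u * B.indicator 1 (g j)) ≤ (1 + u) ^ k * sampleWeight Φ t u k (Sum.elim x g) := by
  set z : Fin n ⊕ Fin N → Z := Sum.elim x g
  obtain ⟨s, hs⟩ := exists_corrections hκ (signedFeature Φ z) rfl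
    (fun i q => Sum.elim (fun i => t ≤ inner ℝ q (Φ (x i)))
      (fun j => g j ∈ B → inner ℝ q (Φ (g j)) < t) i) v
    (by
      rintro (i | j) q hq
      · simp only [Sum.elim_inl, not_le] at hq
        refine ⟨(hx i).1, ?_⟩
        simp only [signedFeature, z, Sum.elim_inl, inner_sub_left]
        linarith [(hx i).2]
      · simp only [Sum.elim_inr, Classical.not_imp, not_lt] at hq
        refine ⟨by simpa [signedFeature, z] using (hB _ hq.1).1, ?_⟩
        simp only [signedFeature, z, Sum.elim_inr, inner_sub_left, inner_neg_right]
        linarith [(hB _ hq.1).2]) k 0 (by simpa using hv)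
  simp only [zero_add] at hs
  set b : Fin n ⊕ Fin N → ℝ≥0∞ := Sum.elim (fun _ => 1) (fun j => 1 + u * B.indicator 1 (g j))
    with hb
  have hbu : ∀ i, b i ≤ 1 + u := by
    rintro (i | j)
    · exact le_self_add
    · simp only [hb, Sum.elim_inr]
      gcongr
      exact mul_le_of_le_one_right' (Set.indicator_le_self' (fun _ _ => zero_le) _)
  have hfree : ∀ i, b i ≤ pointWeight Φ t u (correctionSum Φ s z) i (z i) := by
    rintro (i | j)
    · have h1 : t ≤ inner ℝ (correctionSum Φ s z) (Φ (x i)) := hs (.inl i)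
      simp [hb, pointWeight, z, h1]
    · have h1 : g j ∈ B → inner ℝ (correctionSum Φ s z) (Φ (g j)) < t := hs (.inr j)
      by_cases hj : g j ∈ B
      · simp [hb, pointWeight, z, hj, h1 hj]
      · simp [hb, pointWeight, z, hj]
  calc ∏ j, (1 + u * B.indicator 1 (g j)) = ∏ i, b i := by simp [hb, Fintype.prod_sum_type]
    _ = (∏ i ∈ (freeCoords s)ᶜ, b i) * ∏ i ∈ freeCoords s, b i := by
        rw [mul_comm, Finset.prod_mul_prod_compl]
    _ ≤ (1 + u) ^ k *
        ∏ i ∈ freeCoords s, pointWeight Φ t u (correctionSum Φ s z) i (z i) := by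
        -- At most `k` coordinates are used, and each costs a factor of at most `1 + u`.
        gcongr with i
        · refine (Finset.prod_le_prod' fun i _ => hbu i).trans ?_
          rw [Finset.prod_const]
          exact pow_le_pow_right₀ le_self_add (card_compl_freeCoords_le s)
        · exact hfree i
    _ ≤ _ := by
        gcongr
        exact Finset.single_le_sum (f := fun s : Fin k → Option (Fin n ⊕ Fin N) =>
          ∏ i ∈ freeCoords s, pointWeight Φ t u (correctionSum Φ s z) i (z i))
          (fun _ _ => zero_le) (Finset.mem_univ s)

variable [MeasurableSpace Z]

theorem measurable_pointWeight_comp {α β W : Type*} [MeasurableSpace W] {Φ : Z → H}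
    (hΦ : StronglyMeasurable Φ) (t : ℝ) (u : ℝ≥0∞) {q : W → H} (hq : StronglyMeasurable q)
    {y : W → Z} (hy : Measurable y) (i : α ⊕ β) :
    Measurable fun a => pointWeight Φ t u (q a) i (y a) := by
  have hin : Measurable fun a => inner ℝ (q a) (Φ (y a)) :=
    (hq.inner (hΦ.comp_measurable hy)).measurable
  rcases i with i | i
  · exact (measurable_one (α := ℝ≥0∞)).indicator (measurableSet_le measurable_const hin)
  · exact (((measurable_one (α := ℝ≥0∞)).indicator
      (measurableSet_lt hin measurable_const)).const_mul u).const_add 1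

/-- The integrals are `1 - β` and `1 + uβ`, with `β` the rejection probability; `1 + a ≤ exp a`
makes both exponents linear in `β`, so that they can cancel. -/
theorem lintegral_pointWeight_le {α β : Type*} {Φ : Z → H} (hΦ : StronglyMeasurable Φ)
    (μ : Measure Z) [IsProbabilityMeasure μ] (t : ℝ) (u : NNReal) (q : H) (i : α ⊕ β) :
    ∫⁻ y, pointWeight Φ t u q i y ∂μ ≤ ENNReal.ofReal (Real.exp
      (Sum.elim (fun _ : α => -μ.real {y | inner ℝ q (Φ y) < t})
        (fun _ : β => u * μ.real {y | inner ℝ q (Φ y) < t}) i)) := by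
  have hin : Measurable fun y => inner ℝ q (Φ y) :=
    (stronglyMeasurable_const.inner hΦ).measurable
  have hm : MeasurableSet {y | inner ℝ q (Φ y) < t} := measurableSet_lt hin measurable_const
  have hm' : MeasurableSet {y | t ≤ inner ℝ q (Φ y)} := measurableSet_le measurable_const hin
  rcases i with i | i
  · have hc : {y | t ≤ inner ℝ q (Φ y)} = {y | inner ℝ q (Φ y) < t}ᶜ := by ext; simp
    simp only [pointWeight, Sum.elim_inl]
    rw [lintegral_indicator_one hm', ← ofReal_measureReal, hc, probReal_compl_eq_one_sub hm]
    refine ENNReal.ofReal_le_ofReal ?_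
    have := Real.add_one_le_exp (-μ.real {y | inner ℝ q (Φ y) < t})
    linarith
  · simp only [pointWeight, Sum.elim_inr]
    rw [lintegral_add_left measurable_const, lintegral_const_mul _
      ((measurable_one (α := ℝ≥0∞)).indicator hm), lintegral_indicator_one hm,
      ← ofReal_measureReal, lintegral_const, measure_univ, mul_one,
      ← ENNReal.ofReal_coe_nnreal, ← ENNReal.ofReal_mul u.coe_nonneg, ← ENNReal.ofReal_one,
      ← ENNReal.ofReal_add zero_le_one (by positivity)]
    refine ENNReal.ofReal_le_ofReal ?_
    have := Real.add_one_le_exp ((u : ℝ) * μ.real {y | inner ℝ q (Φ y) < t})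
    linarith

/-- Each record contributes at most `1`, because the exponents over its free coordinates add up to
at most `(uN + k - n)β ≤ 0` whatever `β` is. The bound is then the number of records. -/
theorem lintegral_sampleWeight_le {Φ : Z → H} (hΦ : StronglyMeasurable Φ)
    (μ : Measure Z) [IsProbabilityMeasure μ] (t : ℝ) (u : NNReal) {n N k : ℕ}
    (hu : (u : ℝ) * N + k ≤ n) :
    ∫⁻ z : Fin n ⊕ Fin N → Z, sampleWeight Φ t u k z ∂(Measure.pi fun _ => μ) ≤
      ((n + N + 1) ^ k : ℕ) := by
  have hterm : ∀ s : Fin k → Option (Fin n ⊕ Fin N),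
      ∫⁻ z : Fin n ⊕ Fin N → Z, ∏ i ∈ freeCoords s,
        pointWeight Φ t u (correctionSum Φ s z) i (z i) ∂(Measure.pi fun _ => μ) ≤ 1 := by
    intro s
    refine lintegral_pi_prod_le μ (freeCoords s)
      (fun i z => pointWeight Φ t u (correctionSum Φ s z) i)
      (fun i z => measurable_pointWeight_comp hΦ t u stronglyMeasurable_const measurable_id i)
      (fun i => measurable_pointWeight_comp hΦ t u (stronglyMeasurable_correctionSum hΦ s)
        (measurable_pi_apply i) i)
      (fun z z' h i => by rw [correctionSum_congr Φ s h]) 1 fun z => ?_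
    set q := correctionSum Φ s z
    set β := μ.real {y | inner ℝ q (Φ y) < t}
    have hβ : 0 ≤ β := measureReal_nonneg
    set h : Fin n ⊕ Fin N → ℝ := Sum.elim (fun _ => -β) (fun _ => u * β) with hdef
    calc ∏ i ∈ freeCoords s, ∫⁻ y, pointWeight Φ t u q i y ∂μ
        ≤ ∏ i ∈ freeCoords s, ENNReal.ofReal (Real.exp (h i)) :=
          Finset.prod_le_prod' fun i _ => lintegral_pointWeight_le hΦ μ t u q i
      _ = ENNReal.ofReal (Real.exp (∑ i ∈ freeCoords s, h i)) := by
          rw [Real.exp_sum, ENNReal.ofReal_prod_of_nonneg fun i _ => (Real.exp_pos _).le]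
      _ ≤ 1 := by
          rw [← ENNReal.ofReal_one]
          refine ENNReal.ofReal_le_ofReal (Real.exp_le_one_iff.2 ?_)
          have hsum : ∑ i ∈ freeCoords s, h i + ∑ i ∈ (freeCoords s)ᶜ, h i = ∑ i, h i :=
            Finset.sum_add_sum_compl _ _
          have htot : ∑ i, h i = -(n * β) + N * (u * β) := by
            simp [hdef, Fintype.sum_sum_type]
          -- The worst case is that all used points belong to the first sample, which loses `k`
          -- factors `exp (-β)`.
          have hcompl : -(k * β) ≤ ∑ i ∈ (freeCoords s)ᶜ, h i := by
            have h1 : ∀ i ∈ (freeCoords s)ᶜ, -β ≤ h i := by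
              rintro (i | i) _
              · exact le_rfl
              · simp only [hdef, Sum.elim_inr]
                exact (neg_nonpos.2 hβ).trans (mul_nonneg u.2 hβ)
            have h2 := Finset.card_nsmul_le_sum _ _ _ h1
            have h3 : ((freeCoords s)ᶜ.card : ℝ) ≤ k := by
              exact_mod_cast card_compl_freeCoords_le s
            rw [nsmul_eq_mul] at h2
            nlinarith
          nlinarith
  unfold sampleWeight
  rw [lintegral_finsetSum _ fun s _ => Finset.measurable_prod _ fun i _ =>
    measurable_pointWeight_comp hΦ t u (stronglyMeasurable_correctionSum hΦ s)
      (measurable_pi_apply i) i]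
  refine (Finset.sum_le_sum fun s _ => hterm s).trans_eq ?_
  simp [Fintype.card_option]

/-- The samples that are separated from a set of probability at least `ε` by a vector `v` with
`‖v‖² ≤ k κ²`, with margin `κ²` on both sides of the threshold `t`. -/
def separatedSamples (Φ : Z → H) (μ : Measure Z) (κ t ε : ℝ) (n k : ℕ) : Set (Fin n → Z) :=
  {x | ∃ (v : H) (B : Set Z), MeasurableSet B ∧ ENNReal.ofReal ε ≤ μ B ∧ ‖v‖ ^ 2 ≤ k * κ ^ 2 ∧
    (∀ i, ‖Φ (x i)‖ ≤ κ ∧ t + κ ^ 2 ≤ inner ℝ v (Φ (x i))) ∧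
    ∀ y ∈ B, ‖Φ y‖ ≤ κ ∧ inner ℝ v (Φ y) < t - κ ^ 2}

/-- Markov's inequality for the sample weight averaged over the ghost sample. -/
theorem mul_measure_separatedSamples_le {Φ : Z → H} (hΦ : StronglyMeasurable Φ)
    (μ : Measure Z) [IsProbabilityMeasure μ] {κ : ℝ} (hκ : 0 < κ) (t ε : ℝ) (u : NNReal)
    {n k : ℕ} (N : ℕ) (hu : (u : ℝ) * N + k ≤ n) :
    (1 + u * ENNReal.ofReal ε) ^ N *
      (Measure.pi fun _ : Fin n => μ) (separatedSamples Φ μ κ t ε n k) ≤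
      (1 + u) ^ k * ((n + N + 1) ^ k : ℕ) := by
  set W : (Fin n → Z) × (Fin N → Z) → ℝ≥0∞ :=
    fun p => sampleWeight Φ t u k ((MeasurableEquiv.sumPiEquivProdPi fun _ => Z).symm p) with hW
  have hmeas : Measurable (sampleWeight (α := Fin n) (β := Fin N) Φ t u k) :=
    Finset.measurable_sum _ fun s _ => Finset.measurable_prod _ fun i _ =>
      measurable_pointWeight_comp hΦ t u (stronglyMeasurable_correctionSum hΦ s)
        (measurable_pi_apply i) i
  have hWm : Measurable W := hmeas.comp (MeasurableEquiv.measurable _)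
  have hWe : ∀ x g, W (x, g) = sampleWeight Φ t u k (Sum.elim x g) := by
    intro x g
    simp only [hW]
    congr 1
  have hint : ∫⁻ x, ∫⁻ g, W (x, g) ∂(Measure.pi fun _ : Fin N => μ)
      ∂(Measure.pi fun _ : Fin n => μ) ≤ ((n + N + 1) ^ k : ℕ) := by
    rw [← lintegral_prod _ hWm.aemeasurable]
    refine le_trans (le_of_eq ?_) (lintegral_sampleWeight_le hΦ μ t u hu)
    exact (measurePreserving_sumPiEquivProdPi_symm
      fun _ : Fin n ⊕ Fin N => μ).lintegral_comp hmeas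
  set V : (Fin n → Z) → ℝ≥0∞ :=
    fun x => (1 + u) ^ k * ∫⁻ g, W (x, g) ∂(Measure.pi fun _ : Fin N => μ) with hV
  have hWx : Measurable fun x => ∫⁻ g, W (x, g) ∂(Measure.pi fun _ : Fin N => μ) :=
    hWm.lintegral_prod_right'
  -- The separated set need not be measurable, but `V` is, and no measurable choice of `v` or `B` is
  -- needed.
  have hsub : separatedSamples Φ μ κ t ε n k ⊆ {x | (1 + u * ENNReal.ofReal ε) ^ N ≤ V x} := by
    rintro x ⟨v, B, hBm, hBε, hv, hx, hB⟩
    have hind : Measurable (B.indicator (1 : Z → ℝ≥0∞)) := measurable_one.indicator hBm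
    have hfac : Measurable fun y => 1 + (u : ℝ≥0∞) * B.indicator 1 y :=
      (hind.const_mul _).const_add 1
    calc (1 + u * ENNReal.ofReal ε) ^ N ≤ (1 + u * μ B) ^ N := by gcongr
      _ = ∏ _j : Fin N, ∫⁻ y, (1 + u * B.indicator 1 y) ∂μ := by
          rw [lintegral_add_left measurable_const, lintegral_const_mul _ hind,
            lintegral_indicator_one hBm]
          simp
      _ = ∫⁻ g, ∏ j, (1 + u * B.indicator 1 (g j)) ∂(Measure.pi fun _ : Fin N => μ) :=
          (lintegral_pi_prod μ (fun _ : Fin N => fun y => 1 + (u : ℝ≥0∞) * B.indicator 1 y)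
            fun _ => hfac).symm
      _ ≤ ∫⁻ g, (1 + u) ^ k * W (x, g) ∂(Measure.pi fun _ : Fin N => μ) :=
          lintegral_mono fun g => by
            rw [hWe]
            exact prod_le_sampleWeight hκ u x g v B hv hx hB
      _ = V x := lintegral_const_mul _ (hWm.comp measurable_prodMk_left)
  calc _ ≤ (1 + u * ENNReal.ofReal ε) ^ N * (Measure.pi fun _ : Fin n => μ)
        {x | (1 + u * ENNReal.ofReal ε) ^ N ≤ V x} := by gcongr
    _ ≤ ∫⁻ x, V x ∂(Measure.pi fun _ : Fin n => μ) :=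
        mul_meas_ge_le_lintegral (hWx.const_mul _) _
    _ ≤ _ := by
        rw [hV, lintegral_const_mul _ hWx]
        gcongr

end Ghost

/-! ### The tail bound -/

section Tail

theorem sub_sq_div_two_le_log_one_add {y : ℝ} (hy : 0 ≤ y) : y - y ^ 2 / 2 ≤ Real.log (1 + y) := by
  refine le_trans ?_ (Real.le_log_one_add_of_nonneg hy)
  rw [le_div_iff₀ (by positivity)]
  nlinarith [pow_nonneg hy 3]

variable {Z H : Type*} [NormedAddCommGroup H] [InnerProductSpace ℝ H] [MeasurableSpace Z]

/-- Take `N = n²` ghost points and `u = (n - k)/n²`, so that `uN + k = n` exactly. Such a large `N`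
keeps the second-order loss in `(1 + uε) ^ N` below `exp (1/2)`, while the number of records stays
polynomial in `n` of degree `O(k)`. -/
theorem measure_separatedSamples_le {Φ : Z → H} (hΦ : StronglyMeasurable Φ) (μ : Measure Z)
    [IsProbabilityMeasure μ] {κ : ℝ} (hκ : 0 < κ) (t : ℝ) {ε : ℝ} (hε : 0 ≤ ε) {n k : ℕ}
    (hn : 2 ≤ n) (hk : k ≤ n) :
    (Measure.pi fun _ : Fin n => μ) (separatedSamples Φ μ κ t ε n k) ≤
      ENNReal.ofReal (Real.exp (4 * k * Real.log n + 1 / 2 - ε * (n - k))) := by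
  rcases lt_or_ge 1 ε with h1 | h1
  · have hempty : separatedSamples Φ μ κ t ε n k = ∅ := by
      refine Set.eq_empty_of_forall_notMem ?_
      rintro x ⟨v, B, -, hB, -⟩
      have : ENNReal.ofReal ε ≤ 1 := hB.trans prob_le_one
      exact absurd (ENNReal.ofReal_le_one.1 this) (not_le.2 h1)
    simp [hempty]
  have hnR : (2 : ℝ) ≤ n := by exact_mod_cast hn
  have hn0 : (0 : ℝ) < n := by linarith
  have hkR : (k : ℝ) ≤ n := by exact_mod_cast hk
  set u : NNReal := ⟨((n : ℝ) - k) / n ^ 2, div_nonneg (by linarith) (by positivity)⟩ with hu_def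
  have hu : (u : ℝ) = ((n : ℝ) - k) / n ^ 2 := rfl
  have hu0 : 0 ≤ (u : ℝ) := u.coe_nonneg
  have hu1 : (u : ℝ) ≤ 1 := by
    rw [hu, div_le_one (by positivity)]
    nlinarith [Nat.cast_nonneg (α := ℝ) k]
  have huN : (u : ℝ) * n ^ 2 = n - k := by rw [hu]; field_simp
  have hmain := mul_measure_separatedSamples_le hΦ μ hκ t ε u (k := k) (n := n) (n ^ 2)
    (by push_cast; linarith)
  set A := (Measure.pi fun _ : Fin n => μ) (separatedSamples Φ μ κ t ε n k)
  have hlow : ENNReal.ofReal (Real.exp (ε * (n - k) - 1 / 2)) ≤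
      (1 + u * ENNReal.ofReal ε) ^ (n ^ 2) := by
    rw [← ENNReal.ofReal_coe_nnreal, ← ENNReal.ofReal_mul hu0, ← ENNReal.ofReal_one,
      ← ENNReal.ofReal_add zero_le_one (by positivity), ← ENNReal.ofReal_pow (by positivity)]
    refine ENNReal.ofReal_le_ofReal ?_
    have hy : 0 ≤ (u : ℝ) * ε := by positivity
    rw [← Real.exp_log (show 0 < 1 + (u : ℝ) * ε by positivity), ← Real.exp_nat_mul]
    refine Real.exp_le_exp.2 ?_
    have h2 := mul_le_mul_of_nonneg_left (sub_sq_div_two_le_log_one_add hy)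
      (Nat.cast_nonneg (α := ℝ) (n ^ 2))
    refine le_trans ?_ h2
    push_cast
    have h3 : (n : ℝ) ^ 2 * (u * ε - (u * ε) ^ 2 / 2) =
        ε * (u * n ^ 2) - (n * u * ε) ^ 2 / 2 := by ring
    have h4 : (n : ℝ) * u ≤ 1 := by
      have : (n : ℝ) * u = (n - k) / n := by rw [hu]; field_simp
      rw [this, div_le_one hn0]
      linarith [Nat.cast_nonneg (α := ℝ) k]
    have h5 : (n : ℝ) * u * ε ≤ 1 := mul_le_one₀ h4 hε h1
    have h6 : (n * u * ε : ℝ) ^ 2 ≤ 1 := pow_le_one₀ (by positivity) h5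
    rw [h3, huN]
    linarith
  have hup : (1 + (u : ℝ≥0∞)) ^ k * ((n + n ^ 2 + 1) ^ k : ℕ) ≤
      ENNReal.ofReal (Real.exp (4 * k * Real.log n)) := by
    rw [← ENNReal.ofReal_coe_nnreal, ← ENNReal.ofReal_one,
      ← ENNReal.ofReal_add zero_le_one hu0, ← ENNReal.ofReal_pow (by positivity),
      ← ENNReal.ofReal_natCast, ← ENNReal.ofReal_mul (by positivity)]
    refine ENNReal.ofReal_le_ofReal ?_
    have he : Real.exp (4 * k * Real.log n) = ((n : ℝ) ^ 4) ^ k := by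
      rw [show 4 * k * Real.log n = k * ((4 : ℕ) * Real.log n) by push_cast; ring,
        Real.exp_nat_mul, Real.exp_nat_mul, Real.exp_log hn0]
    rw [he]
    push_cast
    rw [← mul_pow]
    refine pow_le_pow_left₀ (by positivity) ?_ k
    have h7 : (1 + (u : ℝ)) * (n + n ^ 2 + 1) ≤ 2 * (n + n ^ 2 + 1) := by
      gcongr
      linarith
    refine h7.trans ?_
    -- `2(n² + n + 1) ≤ n⁴` for `n ≥ 2`, whence the constant `4` in the exponent.
    have h8 : (4 : ℝ) ≤ n ^ 2 := by nlinarith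
    nlinarith
  have hA : ENNReal.ofReal (Real.exp (ε * (n - k) - 1 / 2)) * A ≤
      ENNReal.ofReal (Real.exp (4 * k * Real.log n)) :=
    (mul_le_mul_left hlow A).trans (hmain.trans hup)
  have hpos := Real.exp_pos (ε * (n - k) - 1 / 2)
  rw [mul_comm, ← ENNReal.le_div_iff_mul_le (.inl (by simpa using hpos)) (.inl ENNReal.ofReal_ne_top),
    ← ENNReal.ofReal_div_of_pos hpos, ← Real.exp_sub] at hA
  refine hA.trans_eq ?_
  congr 2
  ring

end Tail

/-! ### The generalization bound -/

section Generalization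

variable {D n : ℕ} {H : Type*} [NormedAddCommGroup H] [InnerProductSpace ℝ H]

/-- The error level at which a compression by `k` points fails with probability at most `δ / n`. -/
noncomputable def errorLevel (n k : ℕ) (δ : ℝ) : ℝ :=
  (4 * k * Real.log n + 1 / 2 + Real.log (n / δ)) / (n - k)

/-- Write `L` for the logarithm in `hL`. To keep coefficient `1` on `L / n`, the surplus `kL` from
replacing `n - k` by `n` is bounded by `kn`. Since `log n ≥ 1/2`, the terms `1/2 + k` cost at most
`3k log n`, for a total of `7k log n`; then `n - k ≥ n/2` doubles `7` to `14`. -/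
theorem errorLevel_le {n k : ℕ} {δ c : ℝ} (hn : 2 ≤ n) (hδ : 0 < δ) (hk : 1 ≤ k) (hkn : 2 * k < n)
    (hc : 14 * k ≤ c) (hL : Real.log ((n : ℝ) ^ 2 / (2 * δ)) ≤ n) :
    errorLevel n k δ ≤ c * (Real.log n / n) + Real.log ((n : ℝ) ^ 2 / (2 * δ)) / n := by
  have hnR : (2 : ℝ) ≤ n := by exact_mod_cast hn
  have hn0 : (0 : ℝ) < n := by linarith
  have hk1 : (1 : ℝ) ≤ k := by exact_mod_cast hk
  have hknR : 2 * (k : ℝ) < n := by exact_mod_cast hkn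
  have hl : 1 / 2 ≤ Real.log n := by
    have := Real.log_le_log (by norm_num) hnR
    linarith [Real.log_two_gt_d9]
  have hlog : Real.log (n / δ) ≤ Real.log ((n : ℝ) ^ 2 / (2 * δ)) := by
    refine Real.log_le_log (by positivity) ?_
    rw [div_le_div_iff₀ hδ (by positivity)]
    nlinarith [mul_pos hn0 hδ]
  set L := Real.log ((n : ℝ) ^ 2 / (2 * δ))
  set l := Real.log n
  rw [errorLevel, ← mul_div_assoc, ← add_div, div_le_div_iff₀ (by linarith) hn0]
  have h1 : (4 * k * l + 1 / 2 + Real.log (n / δ)) * n ≤ (4 * k * l + 1 / 2 + L) * n := by gcongr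
  have hkl : (k : ℝ) * (1 / 2) ≤ k * l := by gcongr
  have h2 : 4 * k * l + 1 / 2 + k ≤ 7 * (k * l) := by linarith
  have h3 : (4 * k * l + 1 / 2 + k) * n ≤ 7 * (k * l) * n := by gcongr
  have h4 : k * L ≤ k * n := by gcongr
  have h5 : 14 * k * l * (n - k) ≤ c * l * (n - k) := by
    have : 0 ≤ (n : ℝ) - k := by linarith
    gcongr
  have h6 : 14 * (k * l) * (n / 2) ≤ 14 * (k * l) * (n - k) := by
    have : 0 ≤ k * l := by positivity
    gcongr
    linarith
  linarith

/-- A sample in the support that avoids all the exceptional sets gives a classifier of small error. -/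
theorem measureReal_kernelClassifier_neg_le {κ θ δ : ℝ} (hθ : 0 < θ) (hθ1 : θ ≤ 1) (hn : 2 ≤ n)
    (hδ : 0 < δ) (hδ1 : δ < 1) (μ : Measure (Pt D)) [IsProbabilityMeasure μ] {Φ : Pt D → H}
    (hΦ : StronglyMeasurable Φ) (hκ : ∀ z ∈ μ.support, ‖Φ z‖ ≤ κ) (x : Fin n → Pt D)
    (hx : ∀ i, x i ∈ μ.support)
    (hsep : ∀ k < n, x ∉ separatedSamples Φ μ κ ((2 / θ - 1) * κ ^ 2) (errorLevel n k δ) n k)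
    {w : H} {ρ : ℝ} (hw : IsOneClassSVM Φ x w ρ) (hρ : 0 < ρ) {c : ℝ}
    (hc : 112 * κ ^ 2 / (θ ^ 2 * ρ) ≤ c) :
    μ.real {z | kernelClassifier Φ w (-((1 - θ) * ρ)) z < 0} ≤
      c * (Real.log n / n) + Real.log ((n : ℝ) ^ 2 / (2 * δ)) / n := by
  have hnR : (2 : ℝ) ≤ n := by exact_mod_cast hn
  have hn0 : (0 : ℝ) < n := by linarith
  have hl : 1 / 2 ≤ Real.log n := by
    have := Real.log_le_log (by norm_num) hnR
    linarith [Real.log_two_gt_d9]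
  have hwsq := hw.norm_sq_eq
  have hκ0 : 0 ≤ κ := (norm_nonneg _).trans (hκ _ (hx ⟨0, by omega⟩))
  have hρκ : ρ ≤ κ ^ 2 := by
    have h1 : ρ ≤ ‖w‖ * κ := (hw.1 ⟨0, by omega⟩).trans
      ((real_inner_le_norm _ _).trans (by gcongr; exact hκ _ (hx _)))
    nlinarith [sq_nonneg (‖w‖ - κ)]
  have hκpos : 0 < κ := by
    rcases hκ0.eq_or_lt with h | h
    · rw [← h] at hρκ; norm_num at hρκ; linarith
    · exact h
  -- `yκ²` is the squared norm of the rescaled separator. As `y ≥ 1`, rounding up gives `k ≤ 2y`,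
  -- hence `14k ≤ 28y ≤ c`.
  set y := 4 * κ ^ 2 / (θ ^ 2 * ρ) with hy
  have hy4 : 1 ≤ y := by
    rw [hy, one_le_div (by positivity)]
    nlinarith [mul_le_of_le_one_left hρ.le (pow_le_one₀ hθ.le hθ1 : θ ^ 2 ≤ 1)]
  have hcy : 28 * y ≤ c := by
    refine le_trans (le_of_eq ?_) hc
    rw [hy]; ring
  set k := ⌈y⌉₊ with hk
  have hky : y ≤ k := Nat.le_ceil y
  have hky2 : (k : ℝ) ≤ 2 * y := by linarith [Nat.ceil_lt_add_one (by linarith : 0 ≤ y)]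
  have hL0 : 0 ≤ Real.log ((n : ℝ) ^ 2 / (2 * δ)) := by
    refine Real.log_nonneg ?_
    rw [one_le_div (by positivity)]
    nlinarith
  have hc0 : 0 ≤ c := by linarith
  set S := {z | kernelClassifier Φ w (-((1 - θ) * ρ)) z < 0} with hS
  have hS1 : μ.real S ≤ 1 := measureReal_le_one
  -- If `n ≤ 2k`, or if the logarithm exceeds `n`, the right-hand side is at least `1` and the bound
  -- is trivial.
  rcases le_or_gt n (2 * k) with hkn | hkn
  · have hkn' : (n : ℝ) ≤ 2 * k := by exact_mod_cast hkn
    have h1 : 1 ≤ c * (Real.log n / n) := by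
      rw [← mul_div_assoc, one_le_div hn0]
      have : c * (1 / 2) ≤ c * Real.log n := by gcongr
      linarith
    have h2 : 0 ≤ Real.log ((n : ℝ) ^ 2 / (2 * δ)) / n := by positivity
    linarith
  rcases le_or_gt (Real.log ((n : ℝ) ^ 2 / (2 * δ))) n with hL | hL
  swap
  · have h1 : 1 ≤ Real.log ((n : ℝ) ^ 2 / (2 * δ)) / n := by
      rw [one_le_div hn0]; exact hL.le
    have h2 : 0 ≤ c * (Real.log n / n) := by positivity
    linarith
  have hk1 : 1 ≤ k := by
    have : (1 : ℝ) ≤ k := hy4.trans hky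
    exact_mod_cast this
  refine le_trans ?_ (errorLevel_le hn hδ hk1 hkn (by linarith) hL)
  by_contra hlt
  push Not at hlt
  have hSiff : ∀ z, z ∈ S ↔ inner ℝ w (Φ z) < (1 - θ) * ρ := by
    intro z
    simp only [hS, Set.mem_ofPred_eq, kernelClassifier]
    split_ifs with h
    · simp only [Int.reduceLT, false_iff, not_lt]; linarith
    · simp only [Int.reduceNeg, Int.reduceLT, true_iff]; linarith
  have hSm : MeasurableSet S := by
    have : S = {z | inner ℝ w (Φ z) < (1 - θ) * ρ} := Set.ext hSiff
    rw [this]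
    exact measurableSet_lt (stronglyMeasurable_const.inner hΦ).measurable measurable_const
  have hsupp : MeasurableSet μ.support := Measure.isClosed_support.measurableSet
  -- This scaling stretches the gap `θρ` between the levels `ρ` and `(1 - θ)ρ` to `2κ²`, centred at
  -- `(2/θ - 1)κ²`. That threshold does not depend on the sample.
  set r := 2 * κ ^ 2 / (θ * ρ) with hr
  have hr0 : 0 < r := by positivity
  refine hsep k (by omega) ⟨r • w, S ∩ μ.support, hSm.inter hsupp, ?_, ?_, fun i => ⟨hκ _ (hx i), ?_⟩,
    fun z hz => ⟨hκ _ hz.2, ?_⟩⟩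
  · rw [measure_inter_conull Measure.measure_compl_support, ← ofReal_measureReal]
    exact ENNReal.ofReal_le_ofReal hlt.le
  · rw [norm_smul, mul_pow, hwsq, Real.norm_of_nonneg hr0.le]
    have : r ^ 2 * ρ = y * κ ^ 2 := by rw [hr, hy]; field_simp; ring
    rw [this]
    gcongr
  · rw [real_inner_smul_left]
    have h1 : r * ρ ≤ r * inner ℝ w (Φ (x i)) := by gcongr; exact hw.1 i
    refine le_trans (le_of_eq ?_) h1
    rw [hr]; field_simp; ring
  · rw [real_inner_smul_left]
    have h1 : r * inner ℝ w (Φ z) < r * ((1 - θ) * ρ) := by gcongr; exact (hSiff z).1 hz.1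
    refine h1.trans_eq ?_
    rw [hr]; field_simp; ring

/-- The exceptional sets have total probability at most `δ`. -/
theorem measure_exceptional_le {κ : ℝ} (hκ : 0 < κ) {δ : ℝ} (hδ : 0 < δ) (hδ1 : δ < 1) (hn : 2 ≤ n)
    (μ : Measure (Pt D)) [IsProbabilityMeasure μ] {Φ : Pt D → H} (hΦ : StronglyMeasurable Φ)
    (t : ℝ) :
    (Measure.pi fun _ : Fin n => μ) ({x | ∃ i, x i ∉ μ.support} ∪
      ⋃ k ∈ Finset.range n, separatedSamples Φ μ κ t (errorLevel n k δ) n k) ≤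
      ENNReal.ofReal δ := by
  have hnR : (2 : ℝ) ≤ n := by exact_mod_cast hn
  have hn0 : (0 : ℝ) < n := by linarith
  have hnull : (Measure.pi fun _ : Fin n => μ) {x | ∃ i, x i ∉ μ.support} = 0 := by
    rw [Set.ofPred_exists]
    refine measure_iUnion_null fun i => ?_
    exact (Measure.quasiMeasurePreserving_eval (fun _ : Fin n => μ) i).preimage_null
      Measure.measure_compl_support
  -- `errorLevel` is chosen so that the exponent in the tail bound is exactly `-log (n/δ)`.
  have hk : ∀ k ∈ Finset.range n, (Measure.pi fun _ : Fin n => μ)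
      (separatedSamples Φ μ κ t (errorLevel n k δ) n k) ≤ ENNReal.ofReal (δ / n) := by
    intro k hk
    have hkn := Finset.mem_range.1 hk
    have hknR : (k : ℝ) < n := by exact_mod_cast hkn
    have hl : 0 ≤ Real.log n := Real.log_nonneg (by linarith)
    have hl' : 0 ≤ Real.log (n / δ) := Real.log_nonneg (by rw [one_le_div hδ]; linarith)
    have hpos : 0 < (n : ℝ) - k := by linarith
    have hε : 0 ≤ errorLevel n k δ := div_nonneg (by positivity) hpos.le
    refine (measure_separatedSamples_le hΦ μ hκ t hε hn hkn.le).trans_eq ?_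
    rw [errorLevel, div_mul_cancel₀ _ hpos.ne', sub_add_cancel_left, Real.exp_neg,
      Real.exp_log (by positivity), inv_div]
  refine (measure_union_le _ _).trans ?_
  rw [hnull, zero_add]
  refine (measure_biUnion_finset_le _ _).trans ((Finset.sum_le_sum hk).trans_eq ?_)
  rw [Finset.sum_const, Finset.card_range, nsmul_eq_mul, ← ENNReal.ofReal_natCast,
    ← ENNReal.ofReal_mul hn0.le, mul_div_cancel₀ _ hn0.ne']

theorem continuous_flow {F : ℕ → Pt D → Pt D} {τ : ℕ} (hF : ∀ t < τ, Continuous (F t)) :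
    Continuous (flow F τ) := by
  induction τ with
  | zero => exact continuous_id
  | succ τ ih => exact (hF τ (Nat.lt_succ_self τ)).comp (ih fun t ht => hF t (by omega))

end Generalization

theorem withProbAtLeast_of_measure_le {Ω : Type*} [MeasurableSpace Ω] {P : Measure Ω}
    [IsProbabilityMeasure P] {δ : ℝ} (hδ : 0 ≤ δ) {A N : Set Ω} (hN : P N ≤ ENNReal.ofReal δ)
    (hA : Nᶜ ⊆ A) : WithProbAtLeast P (1 - δ) A := by
  refine ⟨(toMeasurable P N)ᶜ, (Set.compl_subset_compl.2 (subset_toMeasurable P N)).trans hA,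
    (measurableSet_toMeasurable P N).compl, ?_⟩
  rw [prob_compl_eq_one_sub (measurableSet_toMeasurable P N), measure_toMeasurable,
    ENNReal.ofReal_sub _ hδ, ENNReal.ofReal_one]
  exact tsub_le_tsub_left hN 1

theorem proposition4p1 (κ θ : ℝ) (hθ : 0 < θ) (hθ1 : θ ≤ 1) :
    ∃ C : ℝ, 0 < C ∧
      ∀ (D d τ n : ℕ) (_hn : 2 ≤ n) (δ ε₀ : ℝ) (_hδ : 0 < δ) (_hε₀ : 0 < ε₀)
        -- the data distribution
        (pdata : Measure (Pt D)) (_hp : IsProbabilityMeasure pdata)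
        (_hM : IsCompact pdata.support)
        -- the source density and the generative model
        (ρ₀ : Measure (Pt D)) (_hρ₀ : IsProbabilityMeasure ρ₀) (_hac : ρ₀ ≪ volume)
        (F : ℕ → Pt D → Pt D) (_hF : ∀ t < τ, ContDiff ℝ 1 (F t))
        -- the optimal transport map from generated samples to data
        (T : Pt D → Pt D) (_hT : IsOptimalTransportMap T (generatedLaw F τ ρ₀) pdata)
        -- `n` independent sample paths, given by their starting points
        (Ω : Type*) (_mΩ : MeasurableSpace Ω) (P : Measure Ω) (_hP : IsProbabilityMeasure P)
        (X₀ : Fin n → Ω → Pt D) (_hlaw : ∀ i, HasLaw (X₀ i) ρ₀ P) (_hind : iIndepFun X₀ P)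
        -- convergence
        (_hconv : WithProbAtLeast P (1 - δ / 2)
          {ω | ∀ i, ‖T (flow F τ (X₀ i ω)) - flow F τ (X₀ i ω)‖ ≤ ε₀})
        -- alignment
        (E : Ω → ℕ → Pt D → Fin d → Pt D) (_hE : ∀ ω, IsMostSensitiveBundle F τ d (E ω))
        (_halign : WithProbAtLeast P (1 - δ / 2)
          {ω | ∀ i, T (flow F τ (X₀ i ω)) ∈ frontier pdata.support →
            Submodule.span ℝ (Set.range (E ω τ (X₀ i ω))) =
              tangentSpaceOf (frontier pdata.support) (T (flow F τ (X₀ i ω)))})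
        -- the feature map of a kernel that is bounded on the support
        (H : Type*) (_nH : NormedAddCommGroup H) (_iH : InnerProductSpace ℝ H)
        (Φ : Pt D → H) (_hΦ : StronglyMeasurable Φ) (_hκ : ∀ z ∈ pdata.support, ‖Φ z‖ ≤ κ),
        ∃ (w : Ω → H) (ρ b : Ω → ℝ) (f : Ω → Pt D → ℤ),
          (∀ ω, IsOneClassSVM Φ (fun i => T (flow F τ (X₀ i ω))) (w ω) (ρ ω)) ∧
          (∀ ω, b ω = -((1 - θ) * ρ ω)) ∧
          (∀ ω, f ω = kernelClassifier Φ (w ω) (b ω)) ∧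
          WithProbAtLeast P (1 - δ)
            {ω | 0 < confidenceMargin Φ (w ω) (b ω) (fun i => T (flow F τ (X₀ i ω))) →
              ∃ c : ℝ, 0 ≤ c ∧
                c ≤ C / confidenceMargin Φ (w ω) (b ω) (fun i => T (flow F τ (X₀ i ω))) ∧
                pdata.real {z | f ω z < 0} ≤
                  c * (Real.log n / n) + Real.log ((n : ℝ) ^ 2 / (2 * δ)) / n} := by
  -- `112 = 28 · 4`, and `m = θρ` absorbs one factor of `θ`; the `+ 1` keeps the constant positive
  -- when `κ = 0`.
  refine ⟨112 * κ ^ 2 / θ + 1, by positivity, ?_⟩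
  intro D d τ n hn δ ε₀ hδ hε₀ pdata hp hM ρ₀ hρ₀ hac F hF T hT Ω mΩ P hP X₀ hlaw hind hconv
    E hE halign H nH iH Φ hΦ hκ
  have hn0 : 0 < n := by omega
  set x : Ω → Fin n → Pt D := fun ω i => T (flow F τ (X₀ i ω)) with hx
  choose w ρ hw using fun ω => exists_isOneClassSVM hn0 Φ (x ω)
  refine ⟨w, ρ, fun ω => -((1 - θ) * ρ ω), fun ω => kernelClassifier Φ (w ω) (-((1 - θ) * ρ ω)),
    hw, fun _ => rfl, fun _ => rfl, ?_⟩
  rcases le_or_gt 1 δ with hδ1 | hδ1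
  · refine ⟨∅, Set.empty_subset _, MeasurableSet.empty, ?_⟩
    rw [ENNReal.ofReal_of_nonpos (by linarith)]
    exact zero_le
  have hflow : Measurable (flow F τ) :=
    (continuous_flow fun t ht => (hF t ht).continuous).measurable
  have hTF : Measurable fun y => T (flow F τ y) := hT.measurable.comp hflow
  have hxm : ∀ i, AEMeasurable (fun ω => T (flow F τ (X₀ i ω))) P := fun i =>
    hTF.comp_aemeasurable (hlaw i).aemeasurable
  have hxlaw : ∀ i, P.map (fun ω => T (flow F τ (X₀ i ω))) = pdata := by
    intro i
    rw [← hT.map_eq, generatedLaw, ← (hlaw i).map_eq,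
      AEMeasurable.map_map_of_aemeasurable hflow.aemeasurable (hlaw i).aemeasurable,
      AEMeasurable.map_map_of_aemeasurable hT.measurable.aemeasurable
        (hflow.comp_aemeasurable (hlaw i).aemeasurable)]
    rfl
  have hjoint : P.map x = Measure.pi fun _ : Fin n => pdata := by
    have := (iIndepFun_iff_map_fun_eq_pi_map hxm).1 (hind.comp _ fun _ => hTF)
    simpa only [hxlaw] using this
  have hxm' : AEMeasurable x P := aemeasurable_pi_lambda _ hxm
  have hpull : ∀ N : Set (Fin n → Pt D), P (x ⁻¹' N) ≤ (Measure.pi fun _ : Fin n => pdata) N := by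
    intro N
    rw [← hjoint]
    exact Measure.le_map_apply hxm' N
  -- For `κ ≤ 0` the features vanish on the support, so almost surely `ρ ≤ 0` and the margin is not
  -- positive.
  rcases le_or_gt κ 0 with hκ0 | hκ0
  · refine withProbAtLeast_of_measure_le hδ.le
      (N := x ⁻¹' {y | ∃ i, y i ∉ pdata.support}) ?_ ?_
    · refine ((hpull _).trans (measure_mono Set.subset_union_left)).trans
        (measure_exceptional_le one_pos hδ hδ1 hn pdata hΦ 0)
    · intro ω hω hm
      exfalso
      simp only [Set.mem_compl_iff, Set.mem_preimage, Set.mem_ofPred_eq, not_exists, not_not] at hω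
      rw [(hw ω).confidenceMargin_eq hn0] at hm
      have hΦ0 : Φ (x ω ⟨0, hn0⟩) = 0 := norm_le_zero_iff.1 ((hκ _ (hω _)).trans hκ0)
      have h1 := (hw ω).1 ⟨0, hn0⟩
      rw [hΦ0, inner_zero_right] at h1
      nlinarith
  · refine withProbAtLeast_of_measure_le hδ.le ((hpull _).trans
      (measure_exceptional_le hκ0 hδ hδ1 hn pdata hΦ ((2 / θ - 1) * κ ^ 2))) ?_
    intro ω hω hm
    simp only [Set.mem_compl_iff, Set.mem_preimage, Set.mem_union, Set.mem_ofPred_eq, not_or,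
      not_exists, not_not, Set.mem_iUnion, Finset.mem_range] at hω
    rw [(hw ω).confidenceMargin_eq hn0] at hm ⊢
    have hmθ : ρ ω + -((1 - θ) * ρ ω) = θ * ρ ω := by ring
    rw [hmθ] at hm ⊢
    have hρ : 0 < ρ ω := pos_of_mul_pos_right hm hθ.le
    refine ⟨(112 * κ ^ 2 / θ + 1) / (θ * ρ ω), by positivity, le_rfl, ?_⟩
    refine measureReal_kernelClassifier_neg_le hθ hθ1 hn hδ hδ1 pdata hΦ hκ (x ω) hω.1
      (fun k hk => hω.2 k hk) (hw ω) hρ ?_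
    calc 112 * κ ^ 2 / (θ ^ 2 * ρ ω) = 112 * κ ^ 2 / θ / (θ * ρ ω) := by field_simp
      _ ≤ _ := by gcongr; linarith
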